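/- Let $V$ be a holomorphic function and $A$ a holomorphic one-form in the variables $(X,Y,Z)$, defined on (the projection to $\mathbb C^3$ of) an open set $M_{\mathbb C}\subset\mathbb C^3\times\mathbb C$ with coordinates $(X,Y,Z,T)$, and satisfying the monopole equation $dV=*dA$, where $*$ is the Hodge star of the flat metric $dX^2-dY^2-dZ^2$ with volume form $dX\wedge dY\wedge dZ$. Consider the holomorphic Gibbons–Hawking metric $$g=V(dX^2-dY^2-dZ^2)+V^{-1}(dT+A)^2,$$ which is singular on $S=\{p\in M_{\mathbb C}: V(p)=0\}$. Its parallel self-dual two-forms are spanned by $$\Sigma^{00}=\sigma(d(X-Y)),\qquad \Sigma^{01}=-\sigma(dZ),\qquad \Sigma^{11}=\sigma(d(X+Y)),\qquad \sigma(\varphi)=(dT+A)\wedge\varphi-V*\varphi ,$$ and are regular on $S$. For $p\in M_{\mathbb C}$ and $\pi=[\pi_0:\pi_1]\in\mathbb{CP}^1$ the $\alpha$-plane of $p$ and $\pi$ is the kernel of $\Sigma(\pi)=\pi_1^2\Sigma^{11}-2\pi_0\pi_1\Sigma^{01}+\pi_0^2\Sigma^{00}$ in $T_pM_{\mathbb C}$;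 for $V(p)\neq 0$ these are the self-dual totally null planes of $g$. An $\alpha$-surface is a maximal connected surface in $M_{\mathbb C}$, with a fixed parameter $\pi$, tangent to the $\alpha$-planes with that parameter. Let $\mathcal Z$ be the twistor space, that is, the set of all $\alpha$-surfaces, assumed (as is the case for instance when $M_{\mathbb C}=U\times\mathbb C$ with $U\subset\mathbb C^3$ convex) to be a complex three-manifold such that the map $\rho: M_{\mathbb C}\times\mathbb{CP}^1\to\mathcal Z$ which sends $(p,\pi)$ to the $\alpha$-surface through $p$ with parameter $\pi$ is a holomorphic submersion. For $p\in M_{\mathbb C}$ let $L_p=\rho(\{p\}\times\mathbb{CP}^1)\subset\mathcal Z$ be the corresponding twistor line, and $N(L_p)=T\mathcal Z|_{L_p}/TL_p$ its normal bundle. Then for every $p\in M_{\mathbb C}$: $p\in S$ if and only if $N(L_p)\cong\mathcal O(2)\oplus\mathcal O$, and $p\notin S$ if and only if $N(L_p)\cong\mathcal O(1)\oplus\mathcal O(1)$. -/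

import Mathlib

open scoped Manifold ContDiff Topology

noncomputable section

namespace GibbonsHawking

/-- Flat three-space with coordinates `(X, Y, Z) = (x 0, x 1, x 2)`. -/
abbrev Base : Type := Fin 3 → ℂ

/-- Four-space with coordinates `((X, Y, Z), T)`. -/
abbrev Total : Type := Base × ℂ

/-- Holomorphic one-forms at a point of three-space. -/
abbrev Covector : Type := Base →L[ℂ] ℂ

/-- The coordinate one-forms `dX, dY, dZ`. -/
def dx (i : Fin 3) : Covector := ContinuousLinearMap.proj i

/-- The coordinate vectors `∂/∂X, ∂/∂Y, ∂/∂Z`. -/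
def e (i : Fin 3) : Base := Pi.single i 1

/-- The flat metric `dX² - dY² - dZ²`. -/
def flat (v w : Base) : ℂ := v 0 * w 0 - v 1 * w 1 - v 2 * w 2

/-- Hodge star of the flat metric from one-forms to two-forms, for the volume form
`dX ∧ dY ∧ dZ`: `*dX = dY ∧ dZ`, `*dY = - dZ ∧ dX`, `*dZ = - dX ∧ dY`. -/
def hodge (φ : Covector) (v w : Base) : ℂ :=
  φ (e 0) * (v 1 * w 2 - v 2 * w 1) - φ (e 1) * (v 2 * w 0 - v 0 * w 2)
    - φ (e 2) * (v 0 * w 1 - v 1 * w 0)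

/-- Hodge star of the flat metric from two-forms to one-forms, for the volume form
`dX ∧ dY ∧ dZ`: `*(dY ∧ dZ) = dX`, `*(dZ ∧ dX) = - dY`, `*(dX ∧ dY) = - dZ`. -/
def hodge₂ (F : Base → Base → ℂ) (v : Base) : ℂ :=
  F (e 1) (e 2) * v 0 - F (e 2) (e 0) * v 1 - F (e 0) (e 1) * v 2

/-- The defining property `α ∧ *β = ⟨α, β⟩ dX ∧ dY ∧ dZ` of the Hodge star, evaluated on
the coordinate vectors; the right-hand side is the inverse of the flat metric. -/
theorem wedge_hodge (α β : Covector) :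
    α (e 0) * hodge β (e 1) (e 2) + α (e 1) * hodge β (e 2) (e 0)
      + α (e 2) * hodge β (e 0) (e 1)
      = α (e 0) * β (e 0) - α (e 1) * β (e 1) - α (e 2) * β (e 2) := by
  simp [hodge, e]
  ring

/-- The two Hodge stars are inverse to each other. -/
theorem hodge₂_hodge (φ : Covector) (v : Base) : hodge₂ (hodge φ) v = φ v := by
  have hv : v = v 0 • e 0 + v 1 • e 1 + v 2 • e 2 := by
    ext i; fin_cases i <;> simp [e]
  conv_rhs => rw [hv]
  simp only [map_add, map_smul, smul_eq_mul]
  simp [hodge₂, hodge, e]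
  ring

/-- The exterior derivative of a one-form `A` on three-space. -/
def extD (A : Base → Covector) (x : Base) (v w : Base) : ℂ :=
  fderiv ℂ A x v w - fderiv ℂ A x w v

/-- `V` and `A` are holomorphic on `U` and satisfy the monopole equation `dV = *dA` there. -/
def IsMonopole (U : Set Base) (V : Base → ℂ) (A : Base → Covector) : Prop :=
  DifferentiableOn ℂ V U ∧ DifferentiableOn ℂ A U ∧
    ∀ x ∈ U, ∀ v, fderiv ℂ V x v = hodge₂ (extD A x) v

/-- The one-form `dT + A` at a point over `x`. -/
def theta (A : Base → Covector) (x : Base) (v : Total) : ℂ := v.2 + A x v.1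

/-- The Gibbons–Hawking metric `V (dX² - dY² - dZ²) + V⁻¹ (dT + A)²`; it is singular on
`V = 0`. -/
def metric (V : Base → ℂ) (A : Base → Covector) (x : Base) (v w : Total) : ℂ :=
  V x * flat v.1 w.1 + (V x)⁻¹ * (theta A x v * theta A x w)

/-- The two-form `(dT + A) ∧ φ - V *φ`.  For `φ` with constant coefficients it is closed by the
monopole equation, and it is regular on `V = 0`. -/
def sdForm (V : Base → ℂ) (A : Base → Covector) (x : Base) (φ : Covector) (v w : Total) : ℂ :=
  theta A x v * φ w.1 - theta A x w * φ v.1 - V x * hodge φ v.1 w.1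

/-- The first element of the parallel basis `Σ⁰⁰, Σ⁰¹, Σ¹¹` of the self-dual two-forms. -/
def sigma00 (V : Base → ℂ) (A : Base → Covector) (x : Base) (v w : Total) : ℂ :=
  sdForm V A x (dx 0 - dx 1) v w

/-- The second element of the parallel basis of the self-dual two-forms. -/
def sigma01 (V : Base → ℂ) (A : Base → Covector) (x : Base) (v w : Total) : ℂ :=
  - sdForm V A x (dx 2) v w

/-- The third element of the parallel basis of the self-dual two-forms. -/
def sigma11 (V : Base → ℂ) (A : Base → Covector) (x : Base) (v w : Total) : ℂ :=
  sdForm V A x (dx 0 + dx 1) v w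

/-- `Σ(π) = π₁² Σ¹¹ - 2 π₀ π₁ Σ⁰¹ + π₀² Σ⁰⁰`, which is `π₁² (Σ¹¹ - 2 λ Σ⁰¹ + λ² Σ⁰⁰)` with
`λ = π₀ / π₁`. -/
def sigma (V : Base → ℂ) (A : Base → Covector) (x : Base) (π : Fin 2 → ℂ) (v w : Total) : ℂ :=
  π 1 ^ 2 * sigma11 V A x v w - 2 * π 0 * π 1 * sigma01 V A x v w + π 0 ^ 2 * sigma00 V A x v w

/-- The alpha-plane at a point over `x` with parameter `[π₀ : π₁]`: the kernel of `Σ(π)`.  Where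
`V ≠ 0` these are the self-dual totally null planes of the metric (see
`metric_eq_zero_of_mem_alphaPlane` and `metric_self_eq_zero_iff`); they extend as planes across
`V = 0`. -/
def alphaPlane (V : Base → ℂ) (A : Base → Covector) (x : Base) (π : Fin 2 → ℂ) :
    Submodule ℂ Total where
  carrier := {v | ∀ w, sigma V A x π v w = 0}
  zero_mem' w := by
    simp [sigma, sigma00, sigma01, sigma11, sdForm, theta, hodge]
  add_mem' {a b} ha hb w := by
    have h : sigma V A x π (a + b) w = sigma V A x π a w + sigma V A x π b w := by
      simp [sigma, sigma00, sigma01, sigma11, sdForm, theta, hodge]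
      ring
    rw [h, ha w, hb w, add_zero]
  smul_mem' c a ha w := by
    have h : sigma V A x π (c • a) w = c * sigma V A x π a w := by
      simp [sigma, sigma00, sigma01, sigma11, sdForm, theta, hodge]
      ring
    rw [h, ha w, mul_zero]

/-- The alpha-planes in coordinates. -/
theorem mem_alphaPlane_iff (V : Base → ℂ) (A : Base → Covector) (x : Base) (π : Fin 2 → ℂ)
    (hπ : π ≠ 0) (v : Total) :
    v ∈ alphaPlane V A x π ↔
      π 0 ^ 2 * (v.1 0 - v.1 1) + 2 * π 0 * π 1 * v.1 2 + π 1 ^ 2 * (v.1 0 + v.1 1) = 0 ∧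
      π 1 * theta A x v + V x * (π 0 * (v.1 0 - v.1 1) + π 1 * v.1 2) = 0 ∧
      π 0 * theta A x v - V x * (π 0 * v.1 2 + π 1 * (v.1 0 + v.1 1)) = 0 := by
  have key : ∀ w : Total, sigma V A x π v w =
      theta A x v * (π 0 ^ 2 * (w.1 0 - w.1 1) + 2 * π 0 * π 1 * w.1 2
        + π 1 ^ 2 * (w.1 0 + w.1 1))
      - theta A x w * (π 0 ^ 2 * (v.1 0 - v.1 1) + 2 * π 0 * π 1 * v.1 2
        + π 1 ^ 2 * (v.1 0 + v.1 1))
      - V x * ((π 0 ^ 2 + π 1 ^ 2) * (v.1 1 * w.1 2 - v.1 2 * w.1 1)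
        - (π 1 ^ 2 - π 0 ^ 2) * (v.1 2 * w.1 0 - v.1 0 * w.1 2)
        - 2 * π 0 * π 1 * (v.1 0 * w.1 1 - v.1 1 * w.1 0)) := by
    intro w
    simp [sigma, sigma00, sigma01, sigma11, sdForm, hodge, dx, e]
    ring
  have hθ : ∀ i, theta A x (e i, - A x (e i)) = 0 := fun i => by simp [theta]
  constructor
  · intro h
    have hT := key (0, 1)
    have h0 := key (e 0, - A x (e 0))
    have h1 := key (e 1, - A x (e 1))
    have h2 := key (e 2, - A x (e 2))
    rw [h] at hT h0 h1 h2
    simp only [hθ] at h0 h1 h2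
    have hT' : theta A x ((0 : Base), (1 : ℂ)) = 1 := by simp [theta]
    rw [hT'] at hT
    simp [e] at hT h0 h1 h2
    refine ⟨by linear_combination hT, ?_⟩
    by_cases p1 : π 1 = 0
    · have p0 : π 0 ≠ 0 := by
        intro p0
        apply hπ
        ext i
        fin_cases i
        · exact p0
        · exact p1
      have E2 : π 0 * theta A x v - V x * (π 0 * v.1 2 + π 1 * (v.1 0 + v.1 1)) = 0 := by
        apply (mul_eq_zero.1 (?_ : 2 * π 0 * _ = 0)).resolve_left (by simpa using p0)
        linear_combination -h0 + h1
      refine ⟨?_, E2⟩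
      apply (mul_eq_zero.1 (?_ : π 0 * _ = 0)).resolve_left p0
      linear_combination -h2 - π 1 * E2
    · have E1 : π 1 * theta A x v + V x * (π 0 * (v.1 0 - v.1 1) + π 1 * v.1 2) = 0 := by
        apply (mul_eq_zero.1 (?_ : 2 * π 1 * _ = 0)).resolve_left (by simpa using p1)
        linear_combination -h0 - h1
      refine ⟨E1, ?_⟩
      apply (mul_eq_zero.1 (?_ : π 1 * _ = 0)).resolve_left p1
      linear_combination -h2 - π 0 * E1
  · rintro ⟨hq, E1, E2⟩ w
    rw [key w, hq]
    linear_combination (w.1 0 * π 1 + w.1 1 * π 1 + w.1 2 * π 0) * E1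
      + (w.1 0 * π 0 - w.1 1 * π 0 + w.1 2 * π 1) * E2

/-- Where `V ≠ 0`, alpha-planes are totally null for the Gibbons–Hawking metric. -/
theorem metric_eq_zero_of_mem_alphaPlane (V : Base → ℂ) (A : Base → Covector) (x : Base)
    (hV : V x ≠ 0) (π : Fin 2 → ℂ) (hπ : π ≠ 0) (v w : Total)
    (hv : v ∈ alphaPlane V A x π) (hw : w ∈ alphaPlane V A x π) :
    metric V A x v w = 0 := by
  obtain ⟨-, E1, E2⟩ := (mem_alphaPlane_iff V A x π hπ v).1 hv
  obtain ⟨-, F1, F2⟩ := (mem_alphaPlane_iff V A x π hπ w).1 hw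
  have h : V x * metric V A x v w = 0 := by
    have h' : V x * metric V A x v w =
        V x ^ 2 * flat v.1 w.1 + theta A x v * theta A x w := by
      simp only [metric]
      field_simp
    rw [h', flat]
    by_cases p1 : π 1 = 0
    · have p0 : π 0 ≠ 0 := by
        intro p0
        apply hπ
        ext i
        fin_cases i
        · exact p0
        · exact p1
      rw [p1] at E1 E2 F1 F2
      have a1 : V x * (v.1 0 - v.1 1) = 0 := by
        apply (mul_eq_zero.1 (?_ : π 0 * _ = 0)).resolve_left p0
        linear_combination E1
      have a2 : theta A x v = V x * v.1 2 := by
        apply mul_left_cancel₀ p0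
        linear_combination E2
      have b1 : V x * (w.1 0 - w.1 1) = 0 := by
        apply (mul_eq_zero.1 (?_ : π 0 * _ = 0)).resolve_left p0
        linear_combination F1
      have b2 : theta A x w = V x * w.1 2 := by
        apply mul_left_cancel₀ p0
        linear_combination F2
      rw [a2, b2]
      linear_combination (1 / 2) * V x * (w.1 0 + w.1 1) * a1
        + (1 / 2) * V x * (v.1 0 + v.1 1) * b1
    · apply (mul_eq_zero.1 (?_ : π 1 * _ = 0)).resolve_left p1
      linear_combination (1 / 2) * (theta A x w - V x * w.1 2) * E1
        + (1 / 2) * (theta A x v - V x * v.1 2) * F1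
        - (1 / 2) * V x * (v.1 0 - v.1 1) * F2
        - (1 / 2) * V x * (w.1 0 - w.1 1) * E2
  exact (mul_eq_zero.1 h).resolve_left hV

/-- Where `V ≠ 0`, a vector is null for the Gibbons–Hawking metric if and only if it lies in an
alpha-plane. -/
theorem metric_self_eq_zero_iff (V : Base → ℂ) (A : Base → Covector) (x : Base)
    (hV : V x ≠ 0) (v : Total) :
    metric V A x v v = 0 ↔ ∃ π : Fin 2 → ℂ, π ≠ 0 ∧ v ∈ alphaPlane V A x π := by
  constructor
  · intro h
    have h' : V x ^ 2 * flat v.1 v.1 + theta A x v * theta A x v = 0 := by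
      have : V x * metric V A x v v = 0 := by rw [h, mul_zero]
      rw [← this, metric]
      field_simp
    rw [flat] at h'
    let N : Matrix (Fin 2) (Fin 2) ℂ :=
      !![V x * (v.1 0 - v.1 1), theta A x v + V x * v.1 2;
        theta A x v - V x * v.1 2, - (V x * (v.1 0 + v.1 1))]
    have hdet : N.det = 0 := by
      rw [Matrix.det_fin_two_of]
      linear_combination -h'
    obtain ⟨π, hπ, hN⟩ := Matrix.exists_mulVec_eq_zero_iff.2 hdet
    have E1 := congrFun hN 0
    have E2 := congrFun hN 1
    simp [N, Matrix.mulVec, dotProduct, Fin.sum_univ_two] at E1 E2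
    refine ⟨π, hπ, (mem_alphaPlane_iff V A x π hπ v).2 ⟨?_, ?_, ?_⟩⟩
    · apply (mul_eq_zero.1 (?_ : V x * _ = 0)).resolve_left hV
      linear_combination π 0 * E1 - π 1 * E2
    · linear_combination E1
    · linear_combination E2
  · rintro ⟨π, hπ, hv⟩
    exact metric_eq_zero_of_mem_alphaPlane V A x hV π hπ v v hv hv


/-- The monopole equation gives `d((dT + A) ∧ φ - V *φ) = dA ∧ φ - dV ∧ *φ = 0` for every `φ` with
constant coefficients (the only coefficient of this three-form on three-space vanishes); so the
forms `Σ(π)` are closed and the distribution of alpha-planes is integrable. -/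
theorem IsMonopole.closed {U : Set Base} {V : Base → ℂ} {A : Base → Covector}
    (h : IsMonopole U V A) {x : Base} (hx : x ∈ U) (φ : Covector) :
    (extD A x (e 1) (e 2) * φ (e 0) + extD A x (e 2) (e 0) * φ (e 1)
        + extD A x (e 0) (e 1) * φ (e 2))
      - (fderiv ℂ V x (e 0) * hodge φ (e 1) (e 2) + fderiv ℂ V x (e 1) * hodge φ (e 2) (e 0)
        + fderiv ℂ V x (e 2) * hodge φ (e 0) (e 1)) = 0 := by
  have h0 := h.2.2 x hx (e 0)
  have h1 := h.2.2 x hx (e 1)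
  have h2 := h.2.2 x hx (e 2)
  rw [h0, h1, h2]
  simp [hodge₂, hodge, e]

/-- The bundle of non-zero spinors `(p, π)` over `M`, `π ∈ ℂ² ∖ {0}`.  Its quotient by the scaling
of `π` is the correspondence space `M × ℂℙ¹` of pairs of a point and an alpha-plane there. -/
def Spinors (M : TopologicalSpace.Opens Total) :
    TopologicalSpace.Opens (Total × (Fin 2 → ℂ)) where
  carrier := {ξ | ξ.1 ∈ M ∧ ξ.2 ≠ 0}
  is_open' := (M.isOpen.preimage continuous_fst).inter
    (isOpen_ne.preimage continuous_snd)

/-- `(p, π)` and `(p', π')` determine the same alpha-surface: `π` and `π'` are proportional, and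
`p` and `p'` are joined by a path in `M` which is everywhere tangent to the alpha-planes with
parameter `[π₀ : π₁]`. -/
def SameAlphaSurface (V : Base → ℂ) (A : Base → Covector) (M : TopologicalSpace.Opens Total)
    (ξ ξ' : Spinors M) : Prop :=
  (∃ c : ℂ, c ≠ 0 ∧ ξ'.1.2 = c • ξ.1.2) ∧
    ∃ γ : ℝ → Total, ContDiffOn ℝ 1 γ (Set.Icc 0 1) ∧ γ 0 = ξ.1.1 ∧ γ 1 = ξ'.1.1 ∧
      ∀ t ∈ Set.Icc (0 : ℝ) 1,
        γ t ∈ M ∧ derivWithin γ (Set.Icc 0 1) t ∈ alphaPlane V A (γ t).1 ξ.1.2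

/-- The twistor space: the space of alpha-surfaces (the maximal connected integral surfaces of the
alpha-plane distributions, together with their parameter in `ℂℙ¹`), with the quotient topology. -/
def TwistorSpace (V : Base → ℂ) (A : Base → Covector) (M : TopologicalSpace.Opens Total) : Type :=
  Quot (SameAlphaSurface V A M)

instance (V : Base → ℂ) (A : Base → Covector) (M : TopologicalSpace.Opens Total) :
    TopologicalSpace (TwistorSpace V A M) :=
  inferInstanceAs (TopologicalSpace (Quot (SameAlphaSurface V A M)))

/-- The projection `ρ` to the twistor space: `(p, π)` is sent to the alpha-surface through `p` with
parameter `[π₀ : π₁]`. -/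
def twistorProj (V : Base → ℂ) (A : Base → Covector) (M : TopologicalSpace.Opens Total)
    (ξ : Spinors M) : TwistorSpace V A M :=
  Quot.mk _ ξ

/-- The given structure of a complex three-manifold on the twistor space is the complex structure
of the space of alpha-surfaces: the projection `ρ` is a holomorphic submersion.  (Such a
structure is unique up to equivalence of atlases; it exists when all the alpha-surfaces in `M` fit
together well, for instance when `M` is `U × ℂ` with `U` convex.) -/
def IsTwistorStructure (V : Base → ℂ) (A : Base → Covector) (M : TopologicalSpace.Opens Total)
    [ChartedSpace (Fin 3 → ℂ) (TwistorSpace V A M)] : Prop :=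
  ContMDiff 𝓘(ℂ, Total × (Fin 2 → ℂ)) 𝓘(ℂ, Fin 3 → ℂ) ω (twistorProj V A M) ∧
    ∀ ξ : Spinors M, Function.Surjective
      (mfderiv 𝓘(ℂ, Total × (Fin 2 → ℂ)) 𝓘(ℂ, Fin 3 → ℂ) (twistorProj V A M) ξ)

/-- The twistor line `L_p`, consisting of the alpha-surfaces through `p`, in the affine coordinate
`lam = π₀ / π₁` of `ℂℙ¹ ∖ {[1 : 0]}`. -/
def twistorLine₀ (V : Base → ℂ) (A : Base → Covector) (M : TopologicalSpace.Opens Total)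
    (p : M) (lam : ℂ) : TwistorSpace V A M :=
  twistorProj V A M ⟨(p.1, ![lam, 1]), p.2, fun h => one_ne_zero (congrFun h 1)⟩

/-- The twistor line `L_p` in the affine coordinate `π₁ / π₀` of `ℂℙ¹ ∖ {[0 : 1]}`. -/
def twistorLine₁ (V : Base → ℂ) (A : Base → Covector) (M : TopologicalSpace.Opens Total)
    (p : M) (lam : ℂ) : TwistorSpace V A M :=
  twistorProj V A M ⟨(p.1, ![1, lam]), p.2, fun h => one_ne_zero (congrFun h 0)⟩

section NormalBundle

variable {Z : Type*} [TopologicalSpace Z] [ChartedSpace (Fin 3 → ℂ) Z]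

/-- The velocity vector of a holomorphic curve. -/
def velocity (c : ℂ → Z) (lam : ℂ) : TangentSpace 𝓘(ℂ, Fin 3 → ℂ) (c lam) :=
  mfderiv 𝓘(ℂ, ℂ) 𝓘(ℂ, Fin 3 → ℂ) c lam (1 : ℂ)

/-- `s 0, s 1` are holomorphic vector fields along the curve `c : ℂ → Z` which, modulo the tangent
line of the curve, are a basis of its normal space at each point: they represent a holomorphic frame
of the normal bundle.  (On `ℂ` every holomorphic section of the normal bundle is represented by a
holomorphic vector field along the curve.) -/
def IsNormalFrame [IsManifold 𝓘(ℂ, Fin 3 → ℂ) ω Z] (c : ℂ → Z)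
    (s : Fin 2 → (lam : ℂ) → TangentSpace 𝓘(ℂ, Fin 3 → ℂ) (c lam)) : Prop :=
  (∀ i, ContMDiff 𝓘(ℂ, ℂ) 𝓘(ℂ, Fin 3 → ℂ).tangent ω
    (fun lam => (⟨c lam, s i lam⟩ : TangentBundle 𝓘(ℂ, Fin 3 → ℂ) Z))) ∧
  ∀ lam, LinearIndependent ℂ ![velocity c lam, s 0 lam, s 1 lam]

/-- Let a rational curve `L` in the complex three-manifold `Z` be given by its restrictions
`c, c' : ℂ → Z` to the two affine pieces of `ℂℙ¹`, with coordinates `lam` and `lam⁻¹`.  Its normal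
bundle `TZ|_L / TL` is isomorphic to `𝒪(k 0) ⊕ 𝒪(k 1)`: there are holomorphic frames over the
two pieces which are related by `s' i = lam ^ k i • s i` modulo the tangent line of `L`, so that the
components of a section satisfy `f' i = lam ^ (- k i) * f i`. -/
def HasNormalBundle [IsManifold 𝓘(ℂ, Fin 3 → ℂ) ω Z] (c c' : ℂ → Z) (k : Fin 2 → ℤ) : Prop :=
  ∃ (s : Fin 2 → (lam : ℂ) → TangentSpace 𝓘(ℂ, Fin 3 → ℂ) (c lam))
    (s' : Fin 2 → (lam : ℂ) → TangentSpace 𝓘(ℂ, Fin 3 → ℂ) (c' lam)),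
    IsNormalFrame c s ∧ IsNormalFrame c' s' ∧
      ∀ i, ∀ lam : ℂ, lam ≠ 0 → ∃ t : ℂ,
        (⟨c' lam⁻¹, s' i lam⁻¹⟩ : TangentBundle 𝓘(ℂ, Fin 3 → ℂ) Z) =
          ⟨c lam, lam ^ k i • s i lam + t • velocity c lam⟩

end NormalBundle

end GibbonsHawking
end

/-!
The normal space of the twistor line `L_p` at the alpha-surface with parameter `[π]` is the quotient
of `T_p M` by the alpha-plane of `π`.  Indeed `ρ` is a submersion, homogeneous of degree zero in `π`,
and it is constant along curves tangent to the alpha-planes of `π`; so the kernel of its differential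
contains the alpha-plane and the direction of `π`, which make up the dimension three of the kernel
(`isNormalFrame_projDeriv`).  That an alpha-plane is contained in the kernel needs no integration of
the distribution: each of its vectors is tangent to a curve over a straight line of three-space,
found by integrating a single function (`exists_curve_of_mem_alphaPlane`).

By `mem_alphaPlane_iff`, the alpha-plane of `π` is, where `V ≠ 0`, the common kernel of two one-forms
linear in `π`; these identify the normal bundle with `𝒪(1) ⊕ 𝒪(1)` (`hasNormalBundle_one_one`).
Where `V = 0` it is the common kernel of a one-form quadratic in `π` and of `dT + A`, which identify
the normal bundle with `𝒪(2) ⊕ 𝒪` (`hasNormalBundle_two_zero`).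

For the converse directions it is enough that the two bundles are not isomorphic
(`not_hasNormalBundle_both`): the components of a map `𝒪(2) → 𝒪(1)` are entire functions `P` such
that `lam * P lam` is bounded at infinity, so they vanish by Liouville's theorem, whereas the
generator of `𝒪(2)` is nowhere tangent to the line.
-/

noncomputable section

namespace GibbonsHawking

/-! ### Curves tangent to the alpha-planes -/

/-- Every vector in an alpha-plane of `π` is tangent to a holomorphic curve in `M` which is
everywhere tangent to the alpha-planes of `π`.  The curve can be taken over a straight line, since
all these planes project onto the same plane of three-space. -/
theorem exists_curve_of_mem_alphaPlane {V : Base → ℂ} {A : Base → Covector}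
    {M : TopologicalSpace.Opens Total} (hVA : IsMonopole (Prod.fst '' (M : Set Total)) V A)
    {p : Total} (hp : p ∈ M) {π : Fin 2 → ℂ} (hπ : π ≠ 0) {v : Total}
    (hv : v ∈ alphaPlane V A p.1 π) :
    ∃ (r : ℝ) (Γ Γ' : ℂ → Total), 0 < r ∧ Γ 0 = p ∧ Γ' 0 = v ∧
      ∀ z ∈ Metric.ball (0 : ℂ) r,
        Γ z ∈ M ∧ HasDerivAt Γ (Γ' z) z ∧ Γ' z ∈ alphaPlane V A (Γ z).1 π := by
  obtain ⟨hq, h1, h2⟩ := (mem_alphaPlane_iff V A p.1 π hπ v).1 hv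
  -- In terms of `a = d(X - Y)(v)`, `b = dZ(v)`, `c = d(X + Y)(v)`, the first equation says that the
  -- vector `(π₀ a + π₁ b, π₀ b + π₁ c)` is a multiple `μ` of `(-π₁, π₀)`.
  obtain ⟨μ, hμ1, hμ2, hμ3⟩ : ∃ μ : ℂ, π 0 * (v.1 0 - v.1 1) + π 1 * v.1 2 = - (π 1 * μ) ∧
      π 0 * v.1 2 + π 1 * (v.1 0 + v.1 1) = π 0 * μ ∧ theta A p.1 v = V p.1 * μ := by
    by_cases p1 : π 1 = 0
    · have p0 : π 0 ≠ 0 := by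
        intro p0
        apply hπ
        ext i
        fin_cases i
        · exact p0
        · exact p1
      have e1 : v.1 0 - v.1 1 = 0 := by
        simpa [p1, p0] using hq
      have e2 : theta A p.1 v - V p.1 * v.1 2 = 0 := by
        apply (mul_eq_zero.1 (?_ : π 0 * _ = 0)).resolve_left p0
        rw [p1] at h2
        linear_combination h2
      refine ⟨v.1 2, ?_, ?_, ?_⟩
      · rw [p1, e1]; ring
      · rw [p1]; ring
      · linear_combination e2
    · refine ⟨-(π 0 * (v.1 0 - v.1 1) + π 1 * v.1 2) / π 1, ?_, ?_, ?_⟩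
      · field_simp
      · field_simp
        linear_combination hq
      · field_simp
        linear_combination h1
  have hU : IsOpen (Prod.fst '' (M : Set Total)) := isOpenMap_fst _ M.isOpen
  let ℓ : ℂ → Base := fun z => p.1 + z • v.1
  have hℓ : ∀ z, HasDerivAt ℓ v.1 z := fun z => by
    have h := ((hasDerivAt_id z).smul_const v.1).const_add p.1
    rwa [one_smul] at h
  have hℓc : Continuous ℓ := by fun_prop
  obtain ⟨r₀, hr₀, hball⟩ := Metric.isOpen_iff.1 (hU.preimage hℓc) 0
    (by simpa [ℓ] using ⟨p.2, hp⟩)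
  -- Over a straight line the tangency condition is `dT/dz = f z`, which is solved by integration.
  let f : ℂ → ℂ := fun z => V (ℓ z) * μ - A (ℓ z) v.1
  have hf : DifferentiableOn ℂ f (Metric.ball 0 r₀) := by
    have hℓd : DifferentiableOn ℂ ℓ (Metric.ball 0 r₀) := fun z _ =>
      (hℓ z).differentiableAt.differentiableWithinAt
    exact ((hVA.1.comp hℓd hball).mul_const μ).sub
      ((hVA.2.1.comp hℓd hball).clm_apply (differentiableOn_const v.1))
  obtain ⟨g, hg0, hg⟩ := hf.isExactOn_ball.with_val_at 0 p.2
  let Γ : ℂ → Total := fun z => (ℓ z, g z)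
  have hΓ0 : Γ 0 = p := by simp [Γ, ℓ, hg0]
  have hΓ : ∀ z ∈ Metric.ball (0 : ℂ) r₀, HasDerivAt Γ (v.1, f z) z := fun z hz =>
    (hℓ z).prodMk (hg z hz)
  have hcont : ContinuousAt Γ 0 := (hΓ 0 (Metric.mem_ball_self hr₀)).continuousAt
  obtain ⟨r₁, hr₁, hball₁⟩ := Metric.mem_nhds_iff.1
    (hcont.preimage_mem_nhds (M.isOpen.mem_nhds (by rw [hΓ0]; exact hp)))
  refine ⟨min r₀ r₁, Γ, fun z => (v.1, f z), lt_min hr₀ hr₁, hΓ0, ?_, fun z hz => ?_⟩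
  · refine Prod.ext rfl ?_
    have : ℓ 0 = p.1 := by simp [ℓ]
    simp only [f, this]
    rw [theta] at hμ3
    linear_combination -hμ3
  · refine ⟨hball₁ (Metric.ball_subset_ball (min_le_right _ _) hz),
      hΓ z (Metric.ball_subset_ball (min_le_left _ _) hz), ?_⟩
    rw [mem_alphaPlane_iff V A _ π hπ]
    have hθ : theta A (Γ z).1 (v.1, f z) = V (ℓ z) * μ := by
      simp [theta, Γ, f]
    rw [hθ]
    refine ⟨hq, ?_, ?_⟩
    · simp only [Γ]
      linear_combination V (ℓ z) * hμ1
    · simp only [Γ]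
      linear_combination - V (ℓ z) * hμ2

/-- The points of a holomorphic curve in a disc which is tangent to the alpha-planes of `π` are all
on the same alpha-surface: they are joined by radial segments. -/
theorem sameAlphaSurface_of_curve {V : Base → ℂ} {A : Base → Covector}
    {M : TopologicalSpace.Opens Total} {π : Fin 2 → ℂ} {r : ℝ} {Γ Γ' : ℂ → Total}
    (h : ∀ z ∈ Metric.ball (0 : ℂ) r,
        Γ z ∈ M ∧ HasDerivAt Γ (Γ' z) z ∧ Γ' z ∈ alphaPlane V A (Γ z).1 π)
    {z : ℂ} (hz : z ∈ Metric.ball (0 : ℂ) r) (ξ ξ' : Spinors M)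
    (hξ : ξ.1 = (Γ 0, π)) (hξ' : ξ'.1 = (Γ z, π)) : SameAlphaSurface V A M ξ ξ' := by
  have hmem : ∀ t ∈ Set.Icc (0 : ℝ) 1, t • z ∈ Metric.ball (0 : ℂ) r := by
    intro t ht
    rw [mem_ball_zero_iff] at hz ⊢
    rw [norm_smul, Real.norm_of_nonneg ht.1]
    exact (mul_le_of_le_one_left (norm_nonneg z) ht.2).trans_lt hz
  have hsm : ContDiffOn ℝ 1 Γ (Metric.ball (0 : ℂ) r) := by
    have hd : DifferentiableOn ℂ Γ (Metric.ball (0 : ℂ) r) := fun w hw =>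
      (h w hw).2.1.differentiableAt.differentiableWithinAt
    exact (hd.contDiffOn Metric.isOpen_ball).restrict_scalars ℝ
  refine ⟨⟨1, one_ne_zero, by rw [hξ, hξ', one_smul]⟩, fun t => Γ (t • z), ?_, ?_, ?_, ?_⟩
  · exact hsm.comp (by fun_prop) hmem
  · simp [hξ]
  · simp [hξ']
  · intro t ht
    obtain ⟨hM, hder, hα⟩ := h _ (hmem t ht)
    refine ⟨hM, ?_⟩
    have h1 : HasDerivAt (fun s : ℝ => s • z) z t := by
      simpa using (hasDerivAt_id t).smul_const z
    have h2 : HasDerivAt (fun s : ℝ => Γ (s • z)) (z • Γ' (t • z)) t :=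
      hder.scomp t h1
    rw [h2.hasDerivWithinAt.derivWithin (uniqueDiffOn_Icc zero_lt_one t ht), hξ]
    exact Submodule.smul_mem _ _ hα

/-- Rescaling the spinor does not change the alpha-surface. -/
theorem sameAlphaSurface_smul {V : Base → ℂ} {A : Base → Covector}
    {M : TopologicalSpace.Opens Total} {c : ℂ} (hc : c ≠ 0) (ξ ξ' : Spinors M)
    (h : ξ'.1 = (ξ.1.1, c • ξ.1.2)) : SameAlphaSurface V A M ξ ξ' := by
  refine ⟨⟨c, hc, by rw [h]⟩, fun _ => ξ.1.1, contDiffOn_const, rfl, by rw [h], ?_⟩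
  intro t _
  refine ⟨ξ.2.1, ?_⟩
  simp

/-! ### The differential of the projection to the twistor space -/

section Projection

variable {V : Base → ℂ} {A : Base → Covector} {M : TopologicalSpace.Opens Total}

/-- The projection to the twistor space as a function on the whole vector space of pairs of a point
and a spinor; outside of `Spinors M` its value is the arbitrary `z₀`. -/
def twistorProjExt (z₀ : TwistorSpace V A M) : Total × (Fin 2 → ℂ) → TwistorSpace V A M :=
  Function.extend Subtype.val (twistorProj V A M) fun _ => z₀

theorem twistorProjExt_coe (z₀ : TwistorSpace V A M) (ξ : Spinors M) :
    twistorProjExt z₀ ξ.1 = twistorProj V A M ξ :=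
  Subtype.val_injective.extend_apply _ _ ξ

theorem twistorProjExt_smul (z₀ : TwistorSpace V A M) {q : Total} {π : Fin 2 → ℂ}
    (h : (q, π) ∈ Spinors M) {c : ℂ} (hc : c ≠ 0) :
    twistorProjExt z₀ (q, c • π) = twistorProjExt z₀ (q, π) := by
  have h' : (q, c • π) ∈ Spinors M := ⟨h.1, smul_ne_zero hc h.2⟩
  rw [twistorProjExt_coe z₀ ⟨_, h⟩, twistorProjExt_coe z₀ ⟨_, h'⟩]
  exact (Quot.sound (sameAlphaSurface_smul hc ⟨_, h⟩ ⟨_, h'⟩ rfl)).symm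

variable [ChartedSpace (Fin 3 → ℂ) (TwistorSpace V A M)]

theorem contMDiffAt_twistorProjExt (hZ : IsTwistorStructure V A M) (z₀ : TwistorSpace V A M)
    {ξ : Total × (Fin 2 → ℂ)} (hξ : ξ ∈ Spinors M) :
    ContMDiffAt 𝓘(ℂ, Total × (Fin 2 → ℂ)) 𝓘(ℂ, Fin 3 → ℂ) ω (twistorProjExt z₀) ξ := by
  refine (contMDiffAt_subtype_iff (U := Spinors M) (x := ⟨ξ, hξ⟩)).1 ?_
  have : (fun x : Spinors M => twistorProjExt z₀ x.1) = twistorProj V A M :=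
    funext (twistorProjExt_coe z₀)
  rw [this]
  exact hZ.1 _

theorem mdifferentiableAt_twistorProjExt (hZ : IsTwistorStructure V A M)
    (z₀ : TwistorSpace V A M) {ξ : Total × (Fin 2 → ℂ)} (hξ : ξ ∈ Spinors M) :
    MDifferentiableAt 𝓘(ℂ, Total × (Fin 2 → ℂ)) 𝓘(ℂ, Fin 3 → ℂ) (twistorProjExt z₀) ξ :=
  (contMDiffAt_twistorProjExt hZ z₀ hξ).mdifferentiableAt (by simp)

/-- The differential of the projection to the twistor space at a spinor, with the tangent space of
the twistor space identified with `ℂ³` by the preferred chart. -/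
def projDeriv (z₀ : TwistorSpace V A M) (ξ : Total × (Fin 2 → ℂ)) :
    Total × (Fin 2 → ℂ) →L[ℂ] (Fin 3 → ℂ) :=
  mfderiv 𝓘(ℂ, Total × (Fin 2 → ℂ)) 𝓘(ℂ, Fin 3 → ℂ) (twistorProjExt z₀) ξ

theorem projDeriv_surjective (hZ : IsTwistorStructure V A M) (z₀ : TwistorSpace V A M)
    {ξ : Total × (Fin 2 → ℂ)} (hξ : ξ ∈ Spinors M) :
    Function.Surjective (projDeriv z₀ ξ) := by
  have h := hZ.2 ⟨ξ, hξ⟩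
  have hcomp : twistorProj V A M = twistorProjExt z₀ ∘ (Subtype.val : Spinors M → _) :=
    (funext (twistorProjExt_coe z₀)).symm
  have hval : MDifferentiableAt 𝓘(ℂ, Total × (Fin 2 → ℂ)) 𝓘(ℂ, Total × (Fin 2 → ℂ))
      (Subtype.val : Spinors M → _) ⟨ξ, hξ⟩ :=
    (contMDiff_subtype_val (n := ω) _).mdifferentiableAt (by simp)
  have hchain := mfderiv_comp (⟨ξ, hξ⟩ : Spinors M)
    (mdifferentiableAt_twistorProjExt hZ z₀ hξ) hval
  intro w
  obtain ⟨u, hu⟩ := h w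
  rw [hcomp, hchain] at hu
  exact ⟨_, hu⟩

/-- The chain rule for a holomorphic curve of spinors. -/
theorem velocity_twistorProjExt_comp (hZ : IsTwistorStructure V A M) (z₀ : TwistorSpace V A M)
    {γ : ℂ → Total × (Fin 2 → ℂ)} {γ' : Total × (Fin 2 → ℂ)} {lam : ℂ}
    (hγ : HasDerivAt γ γ' lam) (hmem : γ lam ∈ Spinors M) :
    velocity (twistorProjExt z₀ ∘ γ) lam = projDeriv z₀ (γ lam) γ' := by
  have h := mfderiv_comp_apply lam (mdifferentiableAt_twistorProjExt hZ z₀ hmem)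
    hγ.differentiableAt.mdifferentiableAt (1 : ℂ)
  refine h.trans ?_
  rw [mfderiv_eq_fderiv]
  have h1 : fderiv ℂ γ lam 1 = γ' := by rw [hγ.hasFDerivAt.fderiv]; simp
  exact congrArg (projDeriv z₀ (γ lam)) h1

/-- If the projection is constant along a holomorphic curve of spinors near a point, then its
differential vanishes on the velocity vector of the curve. -/
theorem projDeriv_eq_zero_of_curve (hZ : IsTwistorStructure V A M) (z₀ : TwistorSpace V A M)
    {γ : ℂ → Total × (Fin 2 → ℂ)} {γ' : Total × (Fin 2 → ℂ)}
    (hγ : HasDerivAt γ γ' 0) (hmem : γ 0 ∈ Spinors M)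
    (hconst : ∀ᶠ z in 𝓝 (0 : ℂ), twistorProjExt z₀ (γ z) = twistorProjExt z₀ (γ 0)) :
    projDeriv z₀ (γ 0) γ' = 0 := by
  rw [← velocity_twistorProjExt_comp hZ z₀ hγ hmem]
  have h : twistorProjExt z₀ ∘ γ =ᶠ[𝓝 0] fun _ => twistorProjExt z₀ (γ 0) := hconst
  have h2 := h.mfderiv_eq (I := 𝓘(ℂ, ℂ)) (I' := 𝓘(ℂ, Fin 3 → ℂ))
  unfold velocity
  rw [h2, mfderiv_const]
  rfl

/-- The alpha-planes are tangent to the fibres of the projection to the twistor space. -/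
theorem projDeriv_of_mem_alphaPlane (hVA : IsMonopole (Prod.fst '' (M : Set Total)) V A)
    (hZ : IsTwistorStructure V A M) (z₀ : TwistorSpace V A M) {q : Total} {π : Fin 2 → ℂ}
    (h : (q, π) ∈ Spinors M) {v : Total} (hv : v ∈ alphaPlane V A q.1 π) :
    projDeriv z₀ (q, π) (v, 0) = 0 := by
  obtain ⟨r, Γ, Γ', hr, h0, h0', hΓ⟩ := exists_curve_of_mem_alphaPlane hVA h.1 h.2 hv
  have hd : HasDerivAt (fun z => (Γ z, π)) (v, 0) 0 := by
    have := (hΓ 0 (Metric.mem_ball_self hr)).2.1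
    rw [h0'] at this
    exact this.prodMk (hasDerivAt_const 0 π)
  have key := projDeriv_eq_zero_of_curve hZ z₀ hd (by simpa only [h0] using h) ?_
  · simpa only [h0] using key
  · filter_upwards [Metric.ball_mem_nhds 0 hr] with z hz
    have m0 : (Γ 0, π) ∈ Spinors M := by rw [h0]; exact h
    have mz : (Γ z, π) ∈ Spinors M := ⟨(hΓ z hz).1, h.2⟩
    rw [twistorProjExt_coe z₀ ⟨_, mz⟩, twistorProjExt_coe z₀ ⟨_, m0⟩]
    exact (Quot.sound (sameAlphaSurface_of_curve hΓ hz ⟨_, m0⟩ ⟨_, mz⟩ rfl rfl)).symm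

/-- The differential of the projection vanishes in the direction of rescaling the spinor. -/
theorem projDeriv_spinor (hZ : IsTwistorStructure V A M) (z₀ : TwistorSpace V A M)
    {q : Total} {π : Fin 2 → ℂ} (h : (q, π) ∈ Spinors M) :
    projDeriv z₀ (q, π) (0, π) = 0 := by
  have hd : HasDerivAt (fun z : ℂ => (q, (1 + z) • π)) (0, π) 0 := by
    have h1 := ((hasDerivAt_id (0 : ℂ)).const_add 1).smul_const π
    rw [one_smul] at h1
    exact (hasDerivAt_const 0 q).prodMk h1
  have key := projDeriv_eq_zero_of_curve hZ z₀ hd (by simpa using h) ?_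
  · simpa using key
  · have : ∀ᶠ z : ℂ in 𝓝 0, 1 + z ≠ 0 :=
      ContinuousAt.eventually_ne (by fun_prop) (by simp)
    filter_upwards [this] with z hz
    rw [twistorProjExt_smul z₀ h hz]
    simp

/-- The scaling of spinors changes neither the projection nor its differential in the directions of
`M`: the projection is homogeneous of degree zero. -/
theorem mk_projDeriv_smul (hZ : IsTwistorStructure V A M) (z₀ : TwistorSpace V A M)
    {q : Total} {π : Fin 2 → ℂ} (h : (q, π) ∈ Spinors M) {c : ℂ} (hc : c ≠ 0) (v : Total) :
    (⟨twistorProjExt z₀ (q, c • π), projDeriv z₀ (q, c • π) (v, 0)⟩ :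
      TangentBundle 𝓘(ℂ, Fin 3 → ℂ) (TwistorSpace V A M)) =
      ⟨twistorProjExt z₀ (q, π), projDeriv z₀ (q, π) (v, 0)⟩ := by
  have hd : ∀ η : Fin 2 → ℂ, HasDerivAt (fun z : ℂ => (q + z • v, η)) (v, 0) 0 := fun η => by
    have h1 := ((hasDerivAt_id (0 : ℂ)).smul_const v).const_add q
    rw [one_smul] at h1
    exact h1.prodMk (hasDerivAt_const 0 η)
  have h' : (q, c • π) ∈ Spinors M := ⟨h.1, smul_ne_zero hc h.2⟩
  have e1 := velocity_twistorProjExt_comp hZ z₀ (hd π) (by simpa using h)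
  have e2 := velocity_twistorProjExt_comp hZ z₀ (hd (c • π)) (by simpa using h')
  have hev : twistorProjExt z₀ ∘ (fun z : ℂ => (q + z • v, c • π)) =ᶠ[𝓝 0]
      twistorProjExt z₀ ∘ (fun z : ℂ => (q + z • v, π)) := by
    have hcont : ContinuousAt (fun z : ℂ => (q + z • v, π)) 0 := by fun_prop
    filter_upwards [hcont.preimage_mem_nhds
      ((Spinors M).isOpen.mem_nhds (by simpa using h))] with z hz
    exact twistorProjExt_smul z₀ hz hc
  have e3 : (velocity (twistorProjExt z₀ ∘ (fun z : ℂ => (q + z • v, c • π))) 0 : Fin 3 → ℂ) =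
      velocity (twistorProjExt z₀ ∘ (fun z : ℂ => (q + z • v, π))) 0 := by
    have h2 := hev.mfderiv_eq (I := 𝓘(ℂ, ℂ)) (I' := 𝓘(ℂ, Fin 3 → ℂ))
    unfold velocity
    rw [h2]
    rfl
  have e4 : projDeriv z₀ (q, c • π) (v, 0) = projDeriv z₀ (q, π) (v, 0) := by
    have h2 : projDeriv z₀ (q + (0 : ℂ) • v, c • π) (v, 0) =
      projDeriv z₀ (q + (0 : ℂ) • v, π) (v, 0) := e2.symm.trans (e3.trans e1)
    simpa using h2
  have e5 : twistorProjExt z₀ (q, c • π) = twistorProjExt z₀ (q, π) := twistorProjExt_smul z₀ h hc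
  rw [e4]
  exact congrArg (fun x => (⟨x, projDeriv z₀ (q, π) (v, 0)⟩ :
      TangentBundle 𝓘(ℂ, Fin 3 → ℂ) (TwistorSpace V A M))) e5

end Projection

/-! ### Frames of the normal bundle of a twistor line -/

section Frames

variable {V : Base → ℂ} {A : Base → Covector} {M : TopologicalSpace.Opens Total}
  [ChartedSpace (Fin 3 → ℂ) (TwistorSpace V A M)]
  [IsManifold 𝓘(ℂ, Fin 3 → ℂ) ω (TwistorSpace V A M)]

theorem contMDiff_mk_projDeriv (hZ : IsTwistorStructure V A M) (z₀ : TwistorSpace V A M)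
    {γ w : ℂ → Total × (Fin 2 → ℂ)} (hγ : ContDiff ℂ ω γ) (hw : ContDiff ℂ ω w)
    (hmem : ∀ lam, γ lam ∈ Spinors M) :
    ContMDiff 𝓘(ℂ, ℂ) 𝓘(ℂ, Fin 3 → ℂ).tangent ω
      (fun lam => (⟨twistorProjExt z₀ (γ lam), projDeriv z₀ (γ lam) (w lam)⟩ :
        TangentBundle 𝓘(ℂ, Fin 3 → ℂ) (TwistorSpace V A M))) := by
  have hon : ContMDiffOn 𝓘(ℂ, Total × (Fin 2 → ℂ)) 𝓘(ℂ, Fin 3 → ℂ) ω (twistorProjExt z₀)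
      (Spinors M : Set (Total × (Fin 2 → ℂ))) := fun ξ hξ =>
    (contMDiffAt_twistorProjExt hZ z₀ hξ).contMDiffWithinAt
  have ht := hon.contMDiffOn_tangentMapWithin (m := ω) le_rfl (Spinors M).isOpen.uniqueMDiffOn
  have hs : ContMDiff 𝓘(ℂ, ℂ) 𝓘(ℂ, Total × (Fin 2 → ℂ)).tangent ω
      (fun lam => (⟨γ lam, w lam⟩ : TangentBundle 𝓘(ℂ, Total × (Fin 2 → ℂ))
        (Total × (Fin 2 → ℂ)))) := by
    intro lam
    rw [Bundle.contMDiffAt_totalSpace]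
    refine ⟨hγ.contMDiff lam, ?_⟩
    simpa using hw.contMDiff lam
  have hcomp := ht.comp_contMDiff hs hmem
  convert! hcomp using 2 with lam
  simp only [Function.comp, tangentMapWithin]
  rw [mfderivWithin_of_isOpen (Spinors M).isOpen (hmem lam)]
  rfl

/-- Along the curve of alpha-surfaces through `q` with the spinors `π lam`, the vector fields `u i`
of `T_q M` which complement the alpha-planes give a frame of the normal bundle, since the kernel of
the differential of the projection contains the alpha-plane and the spinor itself. -/
theorem isNormalFrame_projDeriv (hVA : IsMonopole (Prod.fst '' (M : Set Total)) V A)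
    (hZ : IsTwistorStructure V A M) (z₀ : TwistorSpace V A M) {q : Total}
    {π : ℂ → Fin 2 → ℂ} {d : Fin 2 → ℂ} (hmem : ∀ lam, (q, π lam) ∈ Spinors M)
    (hπ : ContDiff ℂ ω π) (hd : ∀ lam, HasDerivAt π d lam)
    (hspinor : ∀ (lam : ℂ) (η : Fin 2 → ℂ), ∃ a b : ℂ, η = a • π lam + b • d)
    {u : Fin 2 → ℂ → Total} (hu : ∀ i, ContDiff ℂ ω (u i))
    (hspan : ∀ (lam : ℂ) (v : Total), ∃ a b : ℂ,
      v - (a • u 0 lam + b • u 1 lam) ∈ alphaPlane V A q.1 (π lam)) :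
    IsNormalFrame (fun lam : ℂ => twistorProjExt z₀ (q, π lam))
      (fun i lam => projDeriv z₀ (q, π lam) (u i lam, 0)) := by
  refine ⟨fun i => contMDiff_mk_projDeriv hZ z₀ (contDiff_const.prodMk hπ)
    ((hu i).prodMk contDiff_const) hmem, fun lam => ?_⟩
  have hvel : velocity (fun lam : ℂ => twistorProjExt z₀ (q, π lam)) lam =
      projDeriv z₀ (q, π lam) (0, d) :=
    velocity_twistorProjExt_comp hZ z₀ ((hasDerivAt_const lam q).prodMk (hd lam)) (hmem lam)
  rw [hvel]
  refine linearIndependent_of_top_le_span_of_card_eq_finrank (R := ℂ) (M := Fin 3 → ℂ) ?_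
    (by simp)
  -- The twistor space is three-dimensional, so it is enough that the three vectors span.
  rintro x -
  obtain ⟨⟨v, η⟩, rfl⟩ := projDeriv_surjective hZ z₀ (hmem lam) x
  obtain ⟨a, b, hab⟩ := hspan lam v
  obtain ⟨a', b', hη⟩ := hspinor lam η
  have hker := projDeriv_of_mem_alphaPlane hVA hZ z₀ (hmem lam) hab
  have hker' := projDeriv_spinor hZ z₀ (hmem lam)
  have hsum : (v, η) = (v - (a • u 0 lam + b • u 1 lam), (0 : Fin 2 → ℂ)) +
      a' • ((0 : Total), π lam) + b' • ((0 : Total), d) +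
      a • (u 0 lam, (0 : Fin 2 → ℂ)) + b • (u 1 lam, (0 : Fin 2 → ℂ)) := by
    refine Prod.ext ?_ ?_
    · simp only [Prod.fst_add, Prod.smul_fst, smul_zero, add_zero]
      abel
    · simpa using hη
  rw [hsum]
  simp only [map_add, map_smul, hker, hker', smul_zero, zero_add]
  refine Submodule.add_mem _ (Submodule.add_mem _ ?_ ?_) ?_
  · exact Submodule.smul_mem _ _ (Submodule.subset_span ⟨0, rfl⟩)
  · exact Submodule.smul_mem _ _ (Submodule.subset_span ⟨1, rfl⟩)
  · exact Submodule.smul_mem _ _ (Submodule.subset_span ⟨2, rfl⟩)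

/-- Frames of the quotients of `T_p M` by the alpha-planes over the two affine pieces of `ℂℙ¹`, with
the transition functions `lam ^ k i`, split the normal bundle of the twistor line of `p`. -/
theorem hasNormalBundle_of_frames (hVA : IsMonopole (Prod.fst '' (M : Set Total)) V A)
    (hZ : IsTwistorStructure V A M) (p : M) (k : Fin 2 → ℤ) {u u' : Fin 2 → ℂ → Total}
    (hu : ∀ i, ContDiff ℂ ω (u i)) (hu' : ∀ i, ContDiff ℂ ω (u' i))
    (hspan : ∀ (lam : ℂ) (v : Total), ∃ a b : ℂ,
      v - (a • u 0 lam + b • u 1 lam) ∈ alphaPlane V A p.1.1 ![lam, 1])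
    (hspan' : ∀ (lam : ℂ) (v : Total), ∃ a b : ℂ,
      v - (a • u' 0 lam + b • u' 1 lam) ∈ alphaPlane V A p.1.1 ![1, lam])
    (htrans : ∀ i, ∀ lam : ℂ, lam ≠ 0 →
      u' i lam⁻¹ - lam ^ k i • u i lam ∈ alphaPlane V A p.1.1 ![lam, 1]) :
    HasNormalBundle (twistorLine₀ V A M p) (twistorLine₁ V A M p) k := by
  let z₀ : TwistorSpace V A M := twistorLine₀ V A M p 0
  have hm0 : ∀ lam : ℂ, (p.1, ![lam, 1]) ∈ Spinors M := fun lam =>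
    ⟨p.2, fun h => one_ne_zero (congrFun h 1)⟩
  have hm1 : ∀ lam : ℂ, (p.1, ![1, lam]) ∈ Spinors M := fun lam =>
    ⟨p.2, fun h => one_ne_zero (congrFun h 0)⟩
  have hl0 : twistorLine₀ V A M p = fun lam => twistorProjExt z₀ (p.1, ![lam, 1]) :=
    funext fun lam => (twistorProjExt_coe z₀ ⟨_, hm0 lam⟩).symm
  have hl1 : twistorLine₁ V A M p = fun lam => twistorProjExt z₀ (p.1, ![1, lam]) :=
    funext fun lam => (twistorProjExt_coe z₀ ⟨_, hm1 lam⟩).symm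
  rw [hl0, hl1]
  refine ⟨fun i lam => projDeriv z₀ (p.1, ![lam, 1]) (u i lam, 0),
    fun i lam => projDeriv z₀ (p.1, ![1, lam]) (u' i lam, 0), ?_, ?_, fun i lam hlam => ⟨0, ?_⟩⟩
  · refine isNormalFrame_projDeriv hVA hZ z₀ (d := ![1, 0]) hm0 ?_ (fun lam => ?_)
      (fun lam η => ⟨η 1, η 0 - lam * η 1, ?_⟩) hu hspan
    · refine contDiff_pi.2 fun i => ?_
      fin_cases i
      · exact contDiff_id
      · exact contDiff_const
    · refine hasDerivAt_pi.2 fun i => ?_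
      fin_cases i
      · exact hasDerivAt_id lam
      · exact hasDerivAt_const lam 1
    · ext i
      fin_cases i
      · simp
        ring
      · simp
  · refine isNormalFrame_projDeriv hVA hZ z₀ (d := ![0, 1]) hm1 ?_ (fun lam => ?_)
      (fun lam η => ⟨η 0, η 1 - lam * η 0, ?_⟩) hu' hspan'
    · refine contDiff_pi.2 fun i => ?_
      fin_cases i
      · exact contDiff_const
      · exact contDiff_id
    · refine hasDerivAt_pi.2 fun i => ?_
      fin_cases i
      · exact hasDerivAt_const lam 1
      · exact hasDerivAt_id lam
    · ext i
      fin_cases i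
      · simp
      · simp
        ring
  · have hpi : (![1, lam⁻¹] : Fin 2 → ℂ) = lam⁻¹ • ![lam, 1] := by
      ext i; fin_cases i <;> simp [hlam]
    have hsm := mk_projDeriv_smul hZ z₀ (hm0 lam) (inv_ne_zero hlam) (u' i lam⁻¹)
    rw [← hpi] at hsm
    refine hsm.trans ?_
    have hker := projDeriv_of_mem_alphaPlane hVA hZ z₀ (hm0 lam) (htrans i lam hlam)
    have hsub : (u' i lam⁻¹ - lam ^ k i • u i lam, (0 : Fin 2 → ℂ)) =
        (u' i lam⁻¹, 0) - lam ^ k i • (u i lam, (0 : Fin 2 → ℂ)) := by simp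
    rw [hsub, map_sub, map_smul, sub_eq_zero] at hker
    rw [hker, zero_smul, add_zero]
    rfl

end Frames

/-! ### The splitting of the normal bundle -/

section Splitting

variable {V : Base → ℂ} {A : Base → Covector}

theorem theta_add (x : Base) (v w : Total) : theta A x (v + w) = theta A x v + theta A x w := by
  simp only [theta, Prod.snd_add, Prod.fst_add, map_add]
  ring

theorem theta_smul (x : Base) (a : ℂ) (v : Total) : theta A x (a • v) = a * theta A x v := by
  simp only [theta, Prod.smul_snd, Prod.smul_fst, map_smul, smul_eq_mul]
  ring

theorem theta_sub (x : Base) (v w : Total) : theta A x (v - w) = theta A x v - theta A x w := by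
  simp only [theta, Prod.snd_sub, Prod.fst_sub, map_sub]
  ring

/-- The vector over `x` on which `d(X - Y)`, `dZ`, `d(X + Y)` and `dT + A` take the values `a`,
`0`, `c` and `t`. -/
def adaptedVector (A : Base → Covector) (x : Base) (a c t : ℂ) : Total :=
  (![(a + c) / 2, (c - a) / 2, 0], t - A x ![(a + c) / 2, (c - a) / 2, 0])

theorem theta_adaptedVector (x : Base) (a c t : ℂ) :
    theta A x (adaptedVector A x a c t) = t := by
  simp only [theta, adaptedVector, sub_add_cancel]

theorem adaptedVector_zero (x : Base) (a c t : ℂ) :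
    (adaptedVector A x a c t).1 0 = (a + c) / 2 := rfl

theorem adaptedVector_one (x : Base) (a c t : ℂ) :
    (adaptedVector A x a c t).1 1 = (c - a) / 2 := rfl

theorem adaptedVector_two (x : Base) (a c t : ℂ) :
    (adaptedVector A x a c t).1 2 = 0 := rfl

theorem contDiff_adaptedVector (x : Base) {a c t : ℂ → ℂ} (ha : ContDiff ℂ ω a)
    (hc : ContDiff ℂ ω c) (ht : ContDiff ℂ ω t) :
    ContDiff ℂ ω fun lam => adaptedVector A x (a lam) (c lam) (t lam) := by
  have h : ContDiff ℂ ω fun lam => (![(a lam + c lam) / 2, (c lam - a lam) / 2, 0] : Base) := by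
    refine contDiff_pi.2 fun i => ?_
    fin_cases i
    · exact (ha.add hc).div_const 2
    · exact (hc.sub ha).div_const 2
    · exact contDiff_const
  exact h.prodMk (ht.sub ((A x).contDiff.comp h))

variable {M : TopologicalSpace.Opens Total}
  [ChartedSpace (Fin 3 → ℂ) (TwistorSpace V A M)]
  [IsManifold 𝓘(ℂ, Fin 3 → ℂ) ω (TwistorSpace V A M)]

/-- Where `V` vanishes, the alpha-plane of `π` is the kernel of `dT + A` and of a one-form which is
quadratic in `π`, so that the quotient of the tangent space by the alpha-planes is
`𝒪(2) ⊕ 𝒪`. -/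
theorem hasNormalBundle_two_zero (hVA : IsMonopole (Prod.fst '' (M : Set Total)) V A)
    (hZ : IsTwistorStructure V A M) (p : M) (hV : V p.1.1 = 0) :
    HasNormalBundle (twistorLine₀ V A M p) (twistorLine₁ V A M p) ![2, 0] := by
  have hπ0 : ∀ lam : ℂ, ![lam, 1] ≠ 0 := fun lam h => one_ne_zero (congrFun h 1)
  have hπ1 : ∀ lam : ℂ, ![1, lam] ≠ 0 := fun lam h => one_ne_zero (congrFun h 0)
  -- On `u 0, u 1`, and on `u' 0, u' 1`, the quadratic one-form
  -- `π₀² d(X - Y) + 2 π₀ π₁ dZ + π₁² d(X + Y)` takes the values `1, 0`, and `dT + A` the values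
  -- `0, 1`.
  refine hasNormalBundle_of_frames hVA hZ p _
    (u := ![fun _ => adaptedVector A p.1.1 0 1 0, fun _ => adaptedVector A p.1.1 0 0 1])
    (u' := ![fun _ => adaptedVector A p.1.1 1 0 0, fun _ => adaptedVector A p.1.1 0 0 1])
    (fun i => ?_) (fun i => ?_) (fun lam v => ?_) (fun lam v => ?_) (fun i lam hlam => ?_)
  · fin_cases i <;> exact contDiff_const
  · fin_cases i <;> exact contDiff_const
  · refine ⟨lam ^ 2 * (v.1 0 - v.1 1) + 2 * lam * v.1 2 + (v.1 0 + v.1 1), theta A p.1.1 v, ?_⟩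
    rw [mem_alphaPlane_iff _ _ _ _ (hπ0 lam), hV]
    simp [theta_sub, theta_add, theta_smul, theta_adaptedVector, adaptedVector_zero,
      adaptedVector_one, adaptedVector_two]
    ring
  · refine ⟨v.1 0 - v.1 1 + 2 * lam * v.1 2 + lam ^ 2 * (v.1 0 + v.1 1), theta A p.1.1 v, ?_⟩
    rw [mem_alphaPlane_iff _ _ _ _ (hπ1 lam), hV]
    simp [theta_sub, theta_add, theta_smul, theta_adaptedVector, adaptedVector_zero,
      adaptedVector_one, adaptedVector_two]
    ring
  · rw [mem_alphaPlane_iff _ _ _ _ (hπ0 lam), hV]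
    fin_cases i
    · simp [theta_sub, theta_smul, theta_adaptedVector, adaptedVector_zero,
        adaptedVector_one, adaptedVector_two]
      ring
    · simp [theta]

/-- Where `V` does not vanish, the alpha-plane of `π` is the kernel of two one-forms which are
linear in `π`, so that the quotient of the tangent space by the alpha-planes is
`𝒪(1) ⊕ 𝒪(1)`. -/
theorem hasNormalBundle_one_one (hVA : IsMonopole (Prod.fst '' (M : Set Total)) V A)
    (hZ : IsTwistorStructure V A M) (p : M) (hV : V p.1.1 ≠ 0) :
    HasNormalBundle (twistorLine₀ V A M p) (twistorLine₁ V A M p) ![1, 1] := by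
  have hπ0 : ∀ lam : ℂ, ![lam, 1] ≠ 0 := fun lam h => one_ne_zero (congrFun h 1)
  have hπ1 : ∀ lam : ℂ, ![1, lam] ≠ 0 := fun lam h => one_ne_zero (congrFun h 0)
  -- On `u 0, u 1`, and on `u' 0, u' 1`, the one-form
  -- `π₁ (dT + A) + V (π₀ d(X - Y) + π₁ dZ)` takes the values `1, 0`, and the one-form
  -- `π₀ (dT + A) - V (π₀ dZ + π₁ d(X + Y))` the values `0, 1`.
  refine hasNormalBundle_of_frames hVA hZ p _
    (u := ![fun lam => adaptedVector A p.1.1 0 (lam / V p.1.1) 1,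
      fun _ => adaptedVector A p.1.1 0 (-1 / V p.1.1) 0])
    (u' := ![fun _ => adaptedVector A p.1.1 (1 / V p.1.1) 0 0,
      fun lam => adaptedVector A p.1.1 (-lam / V p.1.1) 0 1])
    (fun i => ?_) (fun i => ?_) (fun lam v => ?_) (fun lam v => ?_) (fun i lam hlam => ?_)
  · fin_cases i
    · exact contDiff_adaptedVector _ contDiff_const (contDiff_id.div_const _) contDiff_const
    · exact contDiff_const
  · fin_cases i
    · exact contDiff_const
    · exact contDiff_adaptedVector _ (contDiff_id.neg.div_const _) contDiff_const contDiff_const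
  · refine ⟨theta A p.1.1 v + V p.1.1 * (lam * (v.1 0 - v.1 1) + v.1 2),
      lam * theta A p.1.1 v - V p.1.1 * (lam * v.1 2 + (v.1 0 + v.1 1)), ?_⟩
    rw [mem_alphaPlane_iff _ _ _ _ (hπ0 lam)]
    refine ⟨?_, ?_, ?_⟩ <;>
      simp [theta_sub, theta_add, theta_smul, theta_adaptedVector, adaptedVector_zero,
        adaptedVector_one, adaptedVector_two] <;>
      field_simp <;> ring
  · refine ⟨lam * theta A p.1.1 v + V p.1.1 * (v.1 0 - v.1 1 + lam * v.1 2),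
      theta A p.1.1 v - V p.1.1 * (v.1 2 + lam * (v.1 0 + v.1 1)), ?_⟩
    rw [mem_alphaPlane_iff _ _ _ _ (hπ1 lam)]
    refine ⟨?_, ?_, ?_⟩ <;>
      simp [theta_sub, theta_add, theta_smul, theta_adaptedVector, adaptedVector_zero,
        adaptedVector_one, adaptedVector_two] <;>
      field_simp <;> ring
  · rw [mem_alphaPlane_iff _ _ _ _ (hπ0 lam)]
    fin_cases i
    · refine ⟨?_, ?_, ?_⟩ <;>
        simp [theta_sub, theta_smul, theta_adaptedVector, adaptedVector_zero,
          adaptedVector_one, adaptedVector_two] <;>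
        field_simp <;> ring
    · refine ⟨?_, ?_, ?_⟩ <;>
        simp [theta_sub, theta_smul, theta_adaptedVector, adaptedVector_zero,
          adaptedVector_one, adaptedVector_two] <;>
        field_simp <;> ring

end Splitting

/-! ### The two splittings exclude each other -/

section Uniqueness

variable {Z : Type*} [TopologicalSpace Z] [ChartedSpace (Fin 3 → ℂ) Z]

/-- Cramer's rule: the coefficients of a holomorphic vector field along a curve with respect to a
holomorphic frame of vector fields along the curve are holomorphic. -/
theorem differentiable_frame_coeff [IsManifold 𝓘(ℂ, Fin 3 → ℂ) ω Z] {c : ℂ → Z}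
    {X : Fin 3 → (lam : ℂ) → TangentSpace 𝓘(ℂ, Fin 3 → ℂ) (c lam)}
    {s : (lam : ℂ) → TangentSpace 𝓘(ℂ, Fin 3 → ℂ) (c lam)}
    (hX : ∀ i, ContMDiff 𝓘(ℂ, ℂ) 𝓘(ℂ, Fin 3 → ℂ).tangent ω
      (fun lam => (⟨c lam, X i lam⟩ : TangentBundle 𝓘(ℂ, Fin 3 → ℂ) Z)))
    (hs : ContMDiff 𝓘(ℂ, ℂ) 𝓘(ℂ, Fin 3 → ℂ).tangent ω
      (fun lam => (⟨c lam, s lam⟩ : TangentBundle 𝓘(ℂ, Fin 3 → ℂ) Z)))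
    (hlin : ∀ lam, LinearIndependent ℂ fun i => X i lam) {a : Fin 3 → ℂ → ℂ}
    (hsum : ∀ lam, s lam = ∑ i, a i lam • X i lam) (i : Fin 3) : Differentiable ℂ (a i) := by
  intro lam₀
  let τ := trivializationAt (Fin 3 → ℂ) (TangentSpace 𝓘(ℂ, Fin 3 → ℂ) (M := Z)) (c lam₀)
  have hsec : ∀ Y : (lam : ℂ) → TangentSpace 𝓘(ℂ, Fin 3 → ℂ) (c lam),
      ContMDiff 𝓘(ℂ, ℂ) 𝓘(ℂ, Fin 3 → ℂ).tangent ω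
        (fun lam => (⟨c lam, Y lam⟩ : TangentBundle 𝓘(ℂ, Fin 3 → ℂ) Z)) →
      DifferentiableAt ℂ (fun lam => (τ ⟨c lam, Y lam⟩).2) lam₀ := fun Y hY =>
    ((Bundle.contMDiffAt_totalSpace.1 (hY lam₀)).2.contDiffAt).differentiableAt (by simp)
  have hc : ContinuousAt c lam₀ :=
    (Bundle.contMDiffAt_totalSpace.1 (hs lam₀)).1.continuousAt
  have hbase : ∀ᶠ lam in 𝓝 lam₀, c lam ∈ τ.baseSet :=
    hc.eventually (τ.open_baseSet.mem_nhds
      (FiberBundle.mem_baseSet_trivializationAt' (c lam₀)))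
  let B : ℂ → Matrix (Fin 3) (Fin 3) ℂ := fun lam j => (τ ⟨c lam, X j lam⟩).2
  let S : ℂ → Fin 3 → ℂ := fun lam => (τ ⟨c lam, s lam⟩).2
  have hB : ∀ j, DifferentiableAt ℂ (fun lam => B lam j) lam₀ := fun j => hsec _ (hX j)
  have hS : DifferentiableAt ℂ S lam₀ := hsec _ hs
  have hBS : ∀ᶠ lam in 𝓝 lam₀, (B lam).det ≠ 0 ∧ S lam = ∑ j, a j lam • B lam j := by
    filter_upwards [hbase] with lam hlam
    let L := τ.continuousLinearEquivAt ℂ (c lam) hlam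
    have hL : ∀ w : TangentSpace 𝓘(ℂ, Fin 3 → ℂ) (c lam), (τ ⟨c lam, w⟩).2 = L w := fun w => rfl
    constructor
    · have h1 : LinearIndependent ℂ (B lam).row := (hlin lam).map' L.toLinearMap
        (LinearMap.ker_eq_bot.2 L.injective)
      exact ((Matrix.linearIndependent_rows_iff_isUnit.1 h1).map Matrix.detMonoidHom).ne_zero
    · simp only [S, B, hL, hsum lam, map_sum, map_smul]
  have hcramer : ∀ᶠ lam in 𝓝 lam₀, a i lam = ((B lam).updateRow i (S lam)).det / (B lam).det := by
    filter_upwards [hBS] with lam h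
    rw [h.2, Matrix.det_updateRow_sum, smul_eq_mul, mul_div_cancel_right₀ _ h.1]
  refine DifferentiableAt.congr_of_eventuallyEq ?_ hcramer
  have hentry : ∀ j k, DifferentiableAt ℂ (fun lam => B lam j k) lam₀ := fun j k =>
    differentiableAt_pi.1 (hB j) k
  have hdet : ∀ C : ℂ → Matrix (Fin 3) (Fin 3) ℂ,
      (∀ j k, DifferentiableAt ℂ (fun lam => C lam j k) lam₀) →
      DifferentiableAt ℂ (fun lam => (C lam).det) lam₀ := fun C hC => by
    simp only [Matrix.det_fin_three]
    fun_prop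
  refine (hdet _ fun j k => ?_).div (hdet B hentry) hBS.self_of_nhds.1
  by_cases hj : j = i
  · subst hj
    simpa using differentiableAt_pi.1 hS k
  · simpa [Matrix.updateRow_ne hj] using hentry j k

theorem contMDiff_velocity [IsManifold 𝓘(ℂ, Fin 3 → ℂ) ω Z] {c : ℂ → Z}
    (hc : ContMDiff 𝓘(ℂ, ℂ) 𝓘(ℂ, Fin 3 → ℂ) ω c) :
    ContMDiff 𝓘(ℂ, ℂ) 𝓘(ℂ, Fin 3 → ℂ).tangent ω
      (fun lam => (⟨c lam, velocity c lam⟩ : TangentBundle 𝓘(ℂ, Fin 3 → ℂ) Z)) := by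
  have h1 : ContMDiff 𝓘(ℂ, ℂ) 𝓘(ℂ, ℂ).tangent ω
      (fun lam => (⟨lam, (1 : ℂ)⟩ : TangentBundle 𝓘(ℂ, ℂ) ℂ)) :=
    contMDiff_vectorSpace_iff_contDiff.2 contDiff_const
  exact (hc.contMDiff_tangentMap (m := ω) le_rfl).comp h1

/-- The components of a holomorphic section of the normal bundle with respect to a holomorphic frame
are holomorphic. -/
theorem IsNormalFrame.exists_coeff [IsManifold 𝓘(ℂ, Fin 3 → ℂ) ω Z] {c : ℂ → Z}
    {r : Fin 2 → (lam : ℂ) → TangentSpace 𝓘(ℂ, Fin 3 → ℂ) (c lam)} (hr : IsNormalFrame c r)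
    {s : (lam : ℂ) → TangentSpace 𝓘(ℂ, Fin 3 → ℂ) (c lam)}
    (hs : ContMDiff 𝓘(ℂ, ℂ) 𝓘(ℂ, Fin 3 → ℂ).tangent ω
      (fun lam => (⟨c lam, s lam⟩ : TangentBundle 𝓘(ℂ, Fin 3 → ℂ) Z))) :
    ∃ (t : ℂ → ℂ) (P : Fin 2 → ℂ → ℂ), (∀ j, Differentiable ℂ (P j)) ∧
      ∀ lam, s lam = t lam • velocity c lam + (P 0 lam • r 0 lam + P 1 lam • r 1 lam) := by
  let X : Fin 3 → (lam : ℂ) → TangentSpace 𝓘(ℂ, Fin 3 → ℂ) (c lam) := fun i lam =>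
    (![velocity c lam, r 0 lam, r 1 lam] : Fin 3 → Fin 3 → ℂ) i
  have hc : ContMDiff 𝓘(ℂ, ℂ) 𝓘(ℂ, Fin 3 → ℂ) ω c := fun lam =>
    (Bundle.contMDiffAt_totalSpace.1 (hr.1 0 lam)).1
  have hX : ∀ i, ContMDiff 𝓘(ℂ, ℂ) 𝓘(ℂ, Fin 3 → ℂ).tangent ω
      (fun lam => (⟨c lam, X i lam⟩ : TangentBundle 𝓘(ℂ, Fin 3 → ℂ) Z)) := by
    intro i
    fin_cases i
    · exact contMDiff_velocity hc
    · exact hr.1 0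
    · exact hr.1 1
  have hlin : ∀ lam, LinearIndependent ℂ fun i => X i lam := hr.2
  have hex : ∀ lam, ∃ a : Fin 3 → ℂ, s lam = ∑ i, a i • X i lam := by
    intro lam
    have hspan : Submodule.span ℂ (Set.range fun i => X i lam) = ⊤ :=
      LinearIndependent.span_eq_top_of_card_eq_finrank' (K := ℂ) (V := Fin 3 → ℂ) (hlin lam)
        (by simp)
    have hmem : s lam ∈ Submodule.span ℂ (Set.range fun i => X i lam) := hspan ▸ Submodule.mem_top
    obtain ⟨a, ha⟩ := (Submodule.mem_span_range_iff_exists_fun ℂ).1 hmem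
    exact ⟨a, ha.symm⟩
  choose a ha using hex
  have hd := differentiable_frame_coeff hX hs hlin (a := fun i lam => a lam i) ha
  refine ⟨fun lam => a lam 0, ![fun lam => a lam 1, fun lam => a lam 2], fun j => ?_, fun lam => ?_⟩
  · fin_cases j
    · exact hd 1
    · exact hd 2
  · rw [ha lam, Fin.sum_univ_three, add_assoc]
    rfl

/-- An entire function `P` with `lam * P lam` bounded at infinity vanishes. -/
theorem eq_zero_of_mul_eq_comp_inv {P Q : ℂ → ℂ} (hP : Differentiable ℂ P)
    (hQ : ContinuousAt Q 0) (h : ∀ lam : ℂ, lam ≠ 0 → lam * P lam = Q lam⁻¹) (lam : ℂ) :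
    P lam = 0 := by
  refine hP.apply_eq_of_tendsto_cocompact lam ?_
  have hinv : Filter.Tendsto (fun z : ℂ => z⁻¹) (Filter.cocompact ℂ) (𝓝 0) :=
    Metric.cobounded_eq_cocompact (α := ℂ) ▸ Filter.tendsto_inv₀_cobounded
  have hlim : Filter.Tendsto (fun z : ℂ => z⁻¹ * Q z⁻¹) (Filter.cocompact ℂ) (𝓝 (0 * Q 0)) :=
    hinv.mul (hQ.tendsto.comp hinv)
  rw [zero_mul] at hlim
  refine hlim.congr' ?_
  have hne : ∀ᶠ z : ℂ in Filter.cocompact ℂ, z ≠ 0 :=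
    (Set.finite_singleton (0 : ℂ)).isCompact.compl_mem_cocompact
  filter_upwards [hne] with z hz
  rw [← h z hz]
  field_simp

/-- The velocity vectors of a rational curve in its two affine coordinates. -/
theorem velocity_eq_of_comp_inv {c c' : ℂ → Z} (hc' : ContMDiff 𝓘(ℂ, ℂ) 𝓘(ℂ, Fin 3 → ℂ) ω c')
    (h : ∀ lam : ℂ, lam ≠ 0 → c' lam⁻¹ = c lam) {lam : ℂ} (hlam : lam ≠ 0) :
    (velocity c lam : Fin 3 → ℂ) = -(lam ^ 2)⁻¹ • (velocity c' lam⁻¹ : Fin 3 → ℂ) := by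
  have hev : c =ᶠ[𝓝 lam] c' ∘ fun z => z⁻¹ := by
    filter_upwards [eventually_ne_nhds hlam] with z hz
    exact (h z hz).symm
  have h1 := hev.mfderiv_eq (I := 𝓘(ℂ, ℂ)) (I' := 𝓘(ℂ, Fin 3 → ℂ))
  have hinv := hasDerivAt_inv hlam
  have h2 := mfderiv_comp_apply lam ((hc' lam⁻¹).mdifferentiableAt (by simp))
    (f := fun z : ℂ => z⁻¹) hinv.differentiableAt.mdifferentiableAt (1 : ℂ)
  have h3 : mfderiv 𝓘(ℂ, ℂ) 𝓘(ℂ, ℂ) (fun z : ℂ => z⁻¹) lam (1 : ℂ) = -(lam ^ 2)⁻¹ := by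
    rw [mfderiv_eq_fderiv]
    have : fderiv ℂ (fun z : ℂ => z⁻¹) lam 1 = -(lam ^ 2)⁻¹ := by
      rw [hinv.hasFDerivAt.fderiv]; simp
    exact this
  have h4 : (velocity c lam : Fin 3 → ℂ) =
      mfderiv 𝓘(ℂ, ℂ) 𝓘(ℂ, Fin 3 → ℂ) (c' ∘ fun z => z⁻¹) lam (1 : ℂ) := by
    unfold velocity
    rw [h1]
    rfl
  refine h4.trans (h2.trans ?_)
  rw [h3]
  have h5 := (mfderiv 𝓘(ℂ, ℂ) 𝓘(ℂ, Fin 3 → ℂ) c' lam⁻¹).map_smul (-(lam ^ 2)⁻¹ : ℂ) (1 : ℂ)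
  have h6 : (-(lam ^ 2)⁻¹ : ℂ) • (1 : ℂ) = -(lam ^ 2)⁻¹ := by rw [smul_eq_mul, mul_one]
  exact (congrArg (mfderiv 𝓘(ℂ, ℂ) 𝓘(ℂ, Fin 3 → ℂ) c' lam⁻¹) h6).symm.trans h5

theorem eq_zero_of_linearIndependent_triple {E : Type*} [AddCommGroup E] [Module ℂ E] {x y z : E}
    (h : LinearIndependent ℂ ![x, y, z]) {a b c : ℂ} (h0 : a • x + b • y + c • z = 0) :
    a = 0 ∧ b = 0 ∧ c = 0 := by
  have key := Fintype.linearIndependent_iff.1 h ![a, b, c] (by simpa [Fin.sum_univ_three] using h0)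
  exact ⟨key 0, key 1, key 2⟩

/-- Comparison of the components, in two frames, of a vector of the normal space of a rational curve:
`x, x'` are the velocity vectors, `y i, y' i` the frames, and `v, v'` the vectors. -/
theorem normal_components_of_relations {E : Type*} [AddCommGroup E] [Module ℂ E]
    {x x' y₀ y₁ y₀' y₁' v v' : E} {lam a b₀ b₁ t t' P₀ P₁ Q₀ Q₁ : ℂ} (hlam : lam ≠ 0)
    (hli : LinearIndependent ℂ ![x, y₀, y₁]) (hx : x = -(lam ^ 2)⁻¹ • x')
    (hv : v' = lam ^ 2 • v + a • x) (h₀ : y₀' = lam • y₀ + b₀ • x) (h₁ : y₁' = lam • y₁ + b₁ • x)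
    (hP : v = t • x + (P₀ • y₀ + P₁ • y₁)) (hQ : v' = t' • x' + (Q₀ • y₀' + Q₁ • y₁')) :
    lam * P₀ = Q₀ ∧ lam * P₁ = Q₁ := by
  have hx' : x' = -(lam ^ 2) • x := by
    rw [hx, smul_smul, neg_mul_neg, mul_inv_cancel₀ (pow_ne_zero 2 hlam), one_smul]
  rw [hx', h₀, h₁, hv, hP] at hQ
  have h0 : (lam ^ 2 * t + a + t' * lam ^ 2 - Q₀ * b₀ - Q₁ * b₁) • x +
      (lam ^ 2 * P₀ - Q₀ * lam) • y₀ + (lam ^ 2 * P₁ - Q₁ * lam) • y₁ = 0 := by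
    linear_combination (norm := module) hQ
  obtain ⟨-, h2, h3⟩ := eq_zero_of_linearIndependent_triple hli h0
  constructor
  · apply mul_left_cancel₀ hlam
    linear_combination h2
  · apply mul_left_cancel₀ hlam
    linear_combination h3

/-- The bundles `𝒪(2) ⊕ 𝒪` and `𝒪(1) ⊕ 𝒪(1)` are not isomorphic: there is no non-zero
homomorphism from `𝒪(2)` to `𝒪(1)`. -/
theorem not_hasNormalBundle_both [IsManifold 𝓘(ℂ, Fin 3 → ℂ) ω Z] {c c' : ℂ → Z}
    (h₂ : HasNormalBundle c c' ![2, 0]) : ¬ HasNormalBundle c c' ![1, 1] := by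
  rintro ⟨r, r', hr, hr', hrr⟩
  obtain ⟨s, s', hs, hs', hss⟩ := h₂
  obtain ⟨t, P, hP, hsP⟩ := hr.exists_coeff (hs.1 0)
  obtain ⟨t', Q, hQ, hsQ⟩ := hr'.exists_coeff (hs'.1 0)
  have hc' : ContMDiff 𝓘(ℂ, ℂ) 𝓘(ℂ, Fin 3 → ℂ) ω c' := fun lam =>
    (Bundle.contMDiffAt_totalSpace.1 (hr'.1 0 lam)).1
  have hcc : ∀ lam : ℂ, lam ≠ 0 → c' lam⁻¹ = c lam := fun lam hlam => by
    obtain ⟨_, h⟩ := hss 0 lam hlam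
    exact congrArg Bundle.TotalSpace.proj h
  have hfib : ∀ {x y : Z} {v w : Fin 3 → ℂ},
      (⟨x, v⟩ : TangentBundle 𝓘(ℂ, Fin 3 → ℂ) Z) = ⟨y, w⟩ → v = w := fun h =>
    eq_of_heq (Bundle.TotalSpace.mk.inj h).2
  -- The components of the generator `s 0` of `𝒪(2)` in the frames of `𝒪(1) ⊕ 𝒪(1)`.
  have hPQ : ∀ j, ∀ lam : ℂ, lam ≠ 0 → lam * P j lam = Q j lam⁻¹ := by
    intro j lam hlam
    obtain ⟨a, ha⟩ := hss 0 lam hlam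
    obtain ⟨b₀, hb₀⟩ := hrr 0 lam hlam
    obtain ⟨b₁, hb₁⟩ := hrr 1 lam hlam
    have ea : (s' 0 lam⁻¹ : Fin 3 → ℂ) = _ := hfib ha
    have e0 : (r' 0 lam⁻¹ : Fin 3 → ℂ) = _ := hfib hb₀
    have e1 : (r' 1 lam⁻¹ : Fin 3 → ℂ) = _ := hfib hb₁
    have ev := velocity_eq_of_comp_inv hc' hcc hlam
    have eP := hsP lam
    have eQ := hsQ lam⁻¹
    have hexp2 : lam ^ (![2, 0] : Fin 2 → ℤ) 0 = lam ^ 2 := zpow_ofNat lam 2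
    have hexp0 : lam ^ (![1, 1] : Fin 2 → ℤ) 0 = lam := zpow_one lam
    have hexp1 : lam ^ (![1, 1] : Fin 2 → ℤ) 1 = lam := zpow_one lam
    rw [hexp2] at ea
    rw [hexp0] at e0
    rw [hexp1] at e1
    have hrel := normal_components_of_relations hlam (hr.2 lam) ev ea e0 e1 eP eQ
    fin_cases j
    · exact hrel.1
    · exact hrel.2
  have hP0 : ∀ j lam, P j lam = 0 := fun j =>
    eq_zero_of_mul_eq_comp_inv (hP j) (hQ j).continuous.continuousAt (hPQ j)
  have hs0 := hsP 0
  rw [hP0 0 0, hP0 1 0, zero_smul, zero_smul, add_zero, add_zero] at hs0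
  have hzero : (1 : ℂ) • (s 0 0 : Fin 3 → ℂ) = t 0 • (velocity c 0 : Fin 3 → ℂ) :=
    (one_smul ℂ _).trans hs0
  have hdep : (-t 0) • (velocity c 0 : Fin 3 → ℂ) + (1 : ℂ) • (s 0 0 : Fin 3 → ℂ) +
      (0 : ℂ) • (s 1 0 : Fin 3 → ℂ) = 0 := by
    rw [hzero]
    module
  exact one_ne_zero (eq_zero_of_linearIndependent_triple (E := Fin 3 → ℂ) (hs.2 0) hdep).2.1

end Uniqueness

end GibbonsHawking

end

theorem mainTheorem2 (V : GibbonsHawking.Base → ℂ)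
    (A : GibbonsHawking.Base → GibbonsHawking.Covector)
    (M : TopologicalSpace.Opens GibbonsHawking.Total)
    (hVA : GibbonsHawking.IsMonopole (Prod.fst '' (M : Set GibbonsHawking.Total)) V A)
    [ChartedSpace (Fin 3 → ℂ) (GibbonsHawking.TwistorSpace V A M)]
    [IsManifold 𝓘(ℂ, Fin 3 → ℂ) ω (GibbonsHawking.TwistorSpace V A M)]
    (hZ : GibbonsHawking.IsTwistorStructure V A M) (p : M) :
    (V p.1.1 = 0 ↔
      GibbonsHawking.HasNormalBundle (GibbonsHawking.twistorLine₀ V A M p)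
        (GibbonsHawking.twistorLine₁ V A M p) ![2, 0]) ∧
    (V p.1.1 ≠ 0 ↔
      GibbonsHawking.HasNormalBundle (GibbonsHawking.twistorLine₀ V A M p)
        (GibbonsHawking.twistorLine₁ V A M p) ![1, 1]) := by
  have hex : GibbonsHawking.HasNormalBundle (GibbonsHawking.twistorLine₀ V A M p)
      (GibbonsHawking.twistorLine₁ V A M p) ![2, 0] →
      ¬ GibbonsHawking.HasNormalBundle (GibbonsHawking.twistorLine₀ V A M p)
        (GibbonsHawking.twistorLine₁ V A M p) ![1, 1] :=
    GibbonsHawking.not_hasNormalBundle_both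
  have h₂ := GibbonsHawking.hasNormalBundle_two_zero hVA hZ p
  have h₁ := GibbonsHawking.hasNormalBundle_one_one hVA hZ p
  exact ⟨⟨h₂, fun h => by_contra fun hV => hex h (h₁ hV)⟩,
    ⟨h₁, fun h hV => hex (h₂ hV) h⟩⟩
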